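/- For an integer $k \ge 3$ let $\mathfrak{B}_k(n)$ denote the number of $k$ dots bracelet partitions of $n$, that is, the integers determined by the generating function $$\sum_{n=0}^{\infty}\mathfrak{B}_k(n)q^n=\frac{(-q;q)_\infty}{(q;q)_\infty^{k-1}\,(-q^k;q^k)_\infty},\qquad (a;q)_\infty=\prod_{i=0}^{\infty}(1-aq^i).$$ Then for all integers $\alpha \ge 1$ and $n \ge 0$, $$\mathfrak{B}_{5^{2\alpha-1}}\Bigl(2\cdot 5^{2\alpha}n+\tfrac{101\cdot 5^{2\alpha-1}-1}{12}\Bigr)\equiv 0 \pmod 5,$$ $$\mathfrak{B}_{7^{2\alpha-1}}\Bigl(2\cdot 7^{2\alpha}n+\tfrac{127\cdot 7^{2\alpha-1}-1}{12}\Bigr)\equiv 0 \pmod 7,$$ $$\mathfrak{B}_{11^{2\alpha-1}}\Bigl(2\cdot 11^{2\alpha}n+\tfrac{155\cdot 11^{2\alpha-1}-1}{12}\Bigr)\equiv 0 \pmod{11}.$$ -/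

import Mathlib

open PowerSeries

section QSeries

open scoped PowerSeries.WithPiTopology

/-- The infinite `q`-shifted factorial `(a; q)_∞ = ∏_{i ≥ 0} (1 - a q ^ i)`, for formal power
series `a`, `q` over `ℤ`. The product converges coefficientwise when `q` has zero
constant coefficient. -/
noncomputable def qPochhammerInf (a q : ℤ⟦X⟧) : ℤ⟦X⟧ :=
  ∏' i : ℕ, (1 - a * q ^ i)

theorem multipliable_qPochhammerInf {a q : ℤ⟦X⟧} (hq : constantCoeff q = 0) :
    Multipliable fun i : ℕ => 1 - a * q ^ i := by
  have h : Filter.Tendsto (fun i : ℕ => (-(a * q ^ i)).order) Filter.atTop (nhds ⊤) := by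
    refine ENat.tendsto_nhds_top_iff_natCast_lt.mpr fun n =>
      Filter.eventually_atTop.mpr ⟨n + 1, fun m hm => ?_⟩
    have h1 : (m : ℕ∞) ≤ (q ^ m).order :=
      PowerSeries.le_order_pow_of_constantCoeff_eq_zero m hq
    have h2 : a.order + (q ^ m).order ≤ (a * q ^ m).order := PowerSeries.le_order_mul _ _
    rw [PowerSeries.order_neg]
    calc (n : ℕ∞) < (m : ℕ∞) := by exact_mod_cast hm
      _ ≤ (q ^ m).order := h1
      _ ≤ a.order + (q ^ m).order := le_add_self
      _ ≤ (a * q ^ m).order := h2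
  simpa [sub_eq_add_neg] using
    PowerSeries.WithPiTopology.multipliable_one_add_of_tendsto_order_atTop_nhds_top ℤ h

theorem constantCoeff_qPochhammerInf {a q : ℤ⟦X⟧} (ha : constantCoeff a = 0)
    (hq : constantCoeff q = 0) : constantCoeff (qPochhammerInf a q) = 1 := by
  unfold qPochhammerInf
  rw [(multipliable_qPochhammerInf hq).map_tprod _
    (PowerSeries.WithPiTopology.continuous_constantCoeff ℤ)]
  simp [ha]

end QSeries

/-- The denominator `(q; q)_∞ ^ (k - 1) (-q ^ k; q ^ k)_∞`. -/
noncomputable def braceletDenominator (k : ℕ) : ℤ⟦X⟧ :=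
  qPochhammerInf X X ^ (k - 1) * qPochhammerInf (-X ^ k) (X ^ k)

theorem constantCoeff_braceletDenominator {k : ℕ} (hk : k ≠ 0) :
    constantCoeff (braceletDenominator k) = 1 := by
  have h1 : constantCoeff (qPochhammerInf X X) = 1 :=
    constantCoeff_qPochhammerInf constantCoeff_X constantCoeff_X
  have h2 : constantCoeff (qPochhammerInf (-X ^ k) (X ^ k)) = 1 :=
    constantCoeff_qPochhammerInf (by simp [hk]) (by simp [hk])
  simp [braceletDenominator, h1, h2]

/-- The generating function
`∑ 𝔅_k(n) q ^ n = (-q; q)_∞ / ((q; q)_∞ ^ (k - 1) (-q ^ k; q ^ k)_∞)`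
of the `k` dots bracelet partitions (`k ≥ 3`). The denominator has constant coefficient `1`, so
`invOfUnit _ 1` is its inverse in `ℤ⟦X⟧`. -/
noncomputable def braceletGenFun (k : ℕ) : ℤ⟦X⟧ :=
  qPochhammerInf (-X) X * invOfUnit (braceletDenominator k) 1

theorem braceletGenFun_mul_denominator {k : ℕ} (hk : k ≠ 0) :
    braceletGenFun k * braceletDenominator k = qPochhammerInf (-X) X := by
  rw [braceletGenFun, mul_assoc, mul_comm (invOfUnit _ _),
    mul_invOfUnit _ _ (by simpa using constantCoeff_braceletDenominator hk), mul_one]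

/-- The number `𝔅_k(n)` of `k` dots bracelet partitions of `n` (`k ≥ 3`). -/
noncomputable def braceletCount (k n : ℕ) : ℤ :=
  coeff n (braceletGenFun k)

/-! Write E = (q;q)_∞ (`pentagonalSeries`) and k = p^r. Modulo p, a p^r-th power is the substitution
q ↦ q^(p^r), and (-q;q)_∞ E = E(q^2), so the generating function becomes E(q^2)/E(q^2)^k. The
even-indexed counts are thus the coefficients of E/E(q^k), which is `eulerQuotient`.

Put s = (p^2-1)/24. By the pentagonal number theorem, the terms of E with exponent ≡ s mod p form
±q^s E(q^(p^2)). Extracting this class from E/E(q^k) lowers r by 2, with a further q ↦ q^p; at r = 1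
it leaves ±E^(p-1). Induction (`coeff_eulerQuotient_eq_zero`) reduces everything to one vanishing
progression pn + c of E^(p-1) mod p.

For p = 5 and 7, write E^4 = E·E^3 and E^6 = E^3·E^3, and use Jacobi's series for E^3 with a
quadratic nonresidue argument. For p = 11, E^10·E(q^11) ≡ (E^3)^7, and the required class of this
seventh power lies in the ideal generated by the vanishing classes of (E^3)^4 ≡ E·E(q^11)
(`residuePart_six_pow_seven`). Jacobi's identity itself comes from differentiating the finite
q-binomial theorem. -/

/-! ### Gaussian binomials and a finite form of Jacobi's identity -/

/-- The Gaussian binomial coefficient at an element `q` of a ring. -/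
def gaussBinom {R : Type*} [CommRing R] (q : R) : ℕ → ℕ → R
  | _, 0 => 1
  | 0, _ + 1 => 0
  | n + 1, k + 1 => gaussBinom q n k + q ^ (k + 1) * gaussBinom q n (k + 1)

/-- The finite `q`-Pochhammer symbol `(q; q)_n`. -/
def qFactorial {R : Type*} [CommRing R] (q : R) (n : ℕ) : R :=
  ∏ i ∈ Finset.range n, (1 - q ^ (i + 1))

section GaussBinom

variable {R S : Type*} [CommRing R] [CommRing S]

theorem gaussBinom_zero_right (q : R) (n : ℕ) : gaussBinom q n 0 = 1 := by
  cases n <;> rfl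

theorem gaussBinom_eq_zero_of_lt (q : R) {n k : ℕ} (h : n < k) : gaussBinom q n k = 0 := by
  induction n generalizing k with
  | zero => obtain ⟨k, rfl⟩ := Nat.exists_eq_succ_of_ne_zero h.ne'; rfl
  | succ n ih =>
    obtain ⟨k, rfl⟩ := Nat.exists_eq_succ_of_ne_zero (Nat.ne_zero_of_lt h)
    rw [gaussBinom, ih (by omega), ih (by omega), mul_zero, add_zero]

theorem map_gaussBinom (f : R →+* S) (q : R) (n k : ℕ) :
    f (gaussBinom q n k) = gaussBinom (f q) n k := by
  induction n generalizing k with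
  | zero => cases k <;> simp [gaussBinom]
  | succ n ih => cases k <;> simp [gaussBinom, ih]

theorem gaussBinom_self (q : R) (n : ℕ) : gaussBinom q n n = 1 := by
  induction n with
  | zero => rfl
  | succ n ih => rw [gaussBinom, ih, gaussBinom_eq_zero_of_lt q n.lt_succ_self, mul_zero, add_zero]

theorem qFactorial_succ (q : R) (n : ℕ) :
    qFactorial q (n + 1) = qFactorial q n * (1 - q ^ (n + 1)) :=
  Finset.prod_range_succ _ _

theorem gaussBinom_mul_qFactorial (q : R) (a b : ℕ) :
    gaussBinom q (a + b) a * (qFactorial q a * qFactorial q b) = qFactorial q (a + b) := by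
  induction h : a + b generalizing a b with
  | zero =>
    obtain ⟨rfl, rfl⟩ : a = 0 ∧ b = 0 := by omega
    simp [gaussBinom, qFactorial]
  | succ m ih =>
    rcases a with _ | a
    · obtain rfl : b = m + 1 := by omega
      rw [gaussBinom_zero_right]; simp [qFactorial]
    rcases b with _ | b
    · obtain rfl : a = m := by omega
      rw [gaussBinom_self]; simp [qFactorial]
    have h1 := ih a (b + 1) (by omega)
    have h2 := ih (a + 1) b (by omega)
    obtain rfl : m = a + b + 1 := by omega
    rw [qFactorial_succ] at h1 h2
    rw [gaussBinom, qFactorial_succ q a, qFactorial_succ q b, qFactorial_succ q (a + b + 1)]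
    linear_combination (1 - q ^ (a + 1)) * h1 + q ^ (a + 1) * (1 - q ^ (b + 1)) * h2

/-- The `q`-binomial theorem. -/
theorem prod_add_mul_pow (q x y : R) (n : ℕ) :
    ∏ i ∈ Finset.range n, (y + x * q ^ i) =
      ∑ j ∈ Finset.range (n + 1), gaussBinom q n j * q ^ (j.choose 2) * x ^ j * y ^ (n - j) := by
  induction n generalizing x with
  | zero => simp [gaussBinom]
  | succ n ih =>
    rw [Finset.prod_range_succ']
    have h1 : ∀ i ∈ Finset.range n, y + x * q ^ (i + 1) = y + (x * q) * q ^ i := fun i _ => by ring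
    rw [Finset.prod_congr rfl h1, ih, pow_zero, mul_one, mul_add, Finset.sum_mul, Finset.sum_mul,
      Finset.sum_range_succ' _ (n + 1)]
    have h2 : ∑ j ∈ Finset.range (n + 1),
        gaussBinom q n j * q ^ (j.choose 2) * (x * q) ^ j * y ^ (n - j) * y =
        (∑ j ∈ Finset.range (n + 1), q ^ (j + 1) * gaussBinom q n (j + 1) *
          q ^ ((j + 1).choose 2) * x ^ (j + 1) * y ^ (n - j)) + y ^ (n + 1) := by
      rw [Finset.sum_range_succ', Finset.sum_range_succ _ n,
        gaussBinom_eq_zero_of_lt q n.lt_succ_self]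
      congr 1
      · simp only [mul_zero, zero_mul, add_zero]
        refine Finset.sum_congr rfl fun j hj => ?_
        obtain ⟨d, rfl⟩ := Nat.exists_eq_add_of_lt (Finset.mem_range.mp hj)
        rw [show j + d + 1 - (j + 1) = d by omega, show j + d + 1 - j = d + 1 by omega]
        ring
      · simp [gaussBinom_zero_right, pow_succ]
    have h3 : ∀ j ∈ Finset.range (n + 1),
        gaussBinom q (n + 1) (j + 1) * q ^ ((j + 1).choose 2) * x ^ (j + 1) *
          y ^ (n + 1 - (j + 1)) =
        gaussBinom q n j * q ^ (j.choose 2) * (x * q) ^ j * y ^ (n - j) * x +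
        q ^ (j + 1) * gaussBinom q n (j + 1) * q ^ ((j + 1).choose 2) * x ^ (j + 1) *
          y ^ (n - j) := fun j _ => by
      rw [gaussBinom, Nat.choose_succ_succ' j 1, Nat.choose_one_right, Nat.add_sub_add_right]
      ring
    rw [h2, Finset.sum_congr rfl h3, Finset.sum_add_distrib, gaussBinom_zero_right]
    simp
    ring

/-- Differentiate the q-binomial expansion of ∏ (q^m - X q^i) at its root X = 1. -/
theorem sum_gaussBinom_mul_index (q : R) {m n : ℕ} (hm : m < n) :
    ∑ j ∈ Finset.range (n + 1),
      (-1) ^ j * (j : R) * gaussBinom q n j * q ^ (j.choose 2) * (q ^ m) ^ (n - j) =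
      -q ^ m * ∏ i ∈ (Finset.range n).erase m, (q ^ m - q ^ i) := by
  have h : ∏ i ∈ Finset.range n,
      (Polynomial.C (q ^ m) - Polynomial.X * Polynomial.C (q ^ i)) =
      ∑ j ∈ Finset.range (n + 1), Polynomial.C ((-1) ^ j * gaussBinom q n j * q ^ (j.choose 2) *
        (q ^ m) ^ (n - j)) * Polynomial.X ^ j := by
    have h1 := prod_add_mul_pow (Polynomial.C q) (-Polynomial.X) (Polynomial.C (q ^ m)) n
    simp only [← map_gaussBinom] at h1
    convert h1 using 2 with j _ j _
    · rw [map_pow _ q j]; ring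
    · rw [neg_pow (Polynomial.X : Polynomial R)]
      simp only [map_mul, map_pow, map_neg, map_one]; ring
  have h2 := congrArg (fun f => (Polynomial.derivative f).eval 1) h
  -- The factor i = m vanishes at X = 1, so only the term differentiating it survives.
  rw [← Finset.mul_prod_erase _ _ (Finset.mem_range.mpr hm)] at h2
  simp only [Polynomial.derivative_mul, Polynomial.derivative_sum, Polynomial.derivative_sub,
    Polynomial.derivative_C, Polynomial.derivative_X, Polynomial.derivative_X_pow,
    Polynomial.eval_add, Polynomial.eval_mul, Polynomial.eval_sub, Polynomial.eval_prod,
    Polynomial.eval_C, Polynomial.eval_X, Polynomial.eval_pow, Polynomial.eval_finsetSum,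
    Polynomial.eval_neg, one_pow, one_mul, mul_one, zero_mul, mul_zero,
    zero_sub, add_zero, sub_self, zero_add] at h2
  rw [h2]
  exact Finset.sum_congr rfl fun j _ => by ring

/-- Since n is the middle index, the factors below it and those above it each contribute one copy of
(q;q)_n. -/
theorem prod_erase_pow_sub_pow (q : R) (n : ℕ) :
    ∏ i ∈ (Finset.range (2 * n + 1)).erase n, (q ^ n - q ^ i) =
      (-1) ^ n * q ^ (n.choose 2 + n * n) * qFactorial q n ^ 2 := by
  have h1 : (Finset.range (2 * n + 1)).erase n =
      Finset.range n ∪ (Finset.range n).map (addLeftEmbedding (n + 1)) := by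
    ext i
    simp only [Finset.mem_erase, Finset.mem_range, Finset.mem_union, Finset.mem_map,
      addLeftEmbedding_apply]
    constructor
    · intro h
      rcases lt_or_ge i n with h' | h'
      · exact Or.inl h'
      · exact Or.inr ⟨i - (n + 1), by omega, by omega⟩
    · rintro (h | ⟨a, ha, rfl⟩) <;> omega
  have h2 : Disjoint (Finset.range n) ((Finset.range n).map (addLeftEmbedding (n + 1))) := by
    rw [Finset.disjoint_left]
    intro i hi hi'
    simp only [Finset.mem_range, Finset.mem_map, addLeftEmbedding_apply] at hi hi'
    obtain ⟨a, _, rfl⟩ := hi'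
    omega
  have h3 : ∏ i ∈ Finset.range n, (q ^ n - q ^ i) =
      (-1) ^ n * q ^ (n.choose 2) * qFactorial q n := by
    have h4 : ∀ i ∈ Finset.range n, q ^ n - q ^ i = -1 * (q ^ i * (1 - q ^ (n - 1 - i + 1))) := by
      intro i hi
      obtain ⟨d, rfl⟩ := Nat.exists_eq_add_of_lt (Finset.mem_range.mp hi)
      rw [show i + d + 1 - 1 - i = d by omega]
      ring
    rw [qFactorial, ← Finset.prod_range_reflect (fun i => 1 - q ^ (i + 1)),
      Nat.choose_two_right, ← Finset.sum_range_id, ← Finset.prod_pow_eq_pow_sum,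
      Finset.prod_congr rfl h4, Finset.prod_mul_distrib, Finset.prod_mul_distrib,
      Finset.prod_const, Finset.card_range, mul_assoc]
  rw [h1, Finset.prod_union h2, Finset.prod_map, h3]
  have h4 : ∀ i ∈ Finset.range n, q ^ n - q ^ (addLeftEmbedding (n + 1) i) =
      q ^ n * (1 - q ^ (i + 1)) := fun i _ => by
    rw [addLeftEmbedding_apply]; ring
  rw [Finset.prod_congr rfl h4, Finset.prod_mul_distrib, Finset.prod_const, Finset.card_range,
    ← qFactorial]
  ring

/-- Finite Jacobi identity: as n grows, both Gaussian binomials tend to 1/E, and the weights differ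
by (n+1+k) - (n-k) = 2k+1. -/
theorem qFactorial_sq_eq_sum [IsDomain R] {q : R} (hq : q ≠ 0) (n : ℕ) :
    qFactorial q n ^ 2 = ∑ k ∈ Finset.range (n + 1), (-1) ^ k * q ^ ((k + 1).choose 2) *
      ((n + 1 + k : ℕ) * gaussBinom q (2 * n + 1) (n + 1 + k) -
        (n - k : ℕ) * gaussBinom q (2 * n + 1) (n - k)) := by
  have h := sum_gaussBinom_mul_index q (m := n) (n := 2 * n + 1) (by omega)
  -- Fold the 2n+2 terms about the middle, pairing index n+1+k with n-k.
  rw [prod_erase_pow_sub_pow, show 2 * n + 1 + 1 = (n + 1) + (n + 1) by omega,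
    Finset.sum_range_add, ← Finset.sum_range_reflect, ← Finset.sum_add_distrib] at h
  have hc : (-1 : R) ^ (n + 1) * q ^ (n + n.choose 2 + n * n) ≠ 0 :=
    mul_ne_zero (pow_ne_zero _ (neg_ne_zero.mpr one_ne_zero)) (pow_ne_zero _ hq)
  apply mul_left_cancel₀ hc
  have h0 : -q ^ n * ((-1) ^ n * q ^ (n.choose 2 + n * n) * qFactorial q n ^ 2) =
    (-1 : R) ^ (n + 1) * q ^ (n + n.choose 2 + n * n) * qFactorial q n ^ 2 := by ring
  rw [← h0, ← h, Finset.mul_sum]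
  refine Finset.sum_congr rfl fun k hk => ?_
  obtain ⟨d, rfl⟩ := Nat.exists_eq_add_of_le (Finset.mem_range_succ_iff.mp hk)
  rw [show k + d + 1 - 1 - k = d by omega, show k + d - k = d by omega,
    show 2 * (k + d) + 1 - d = 2 * k + d + 1 by omega,
    show 2 * (k + d) + 1 - (k + d + 1 + k) = d by omega]
  have e1 : (q ^ (k + d)) ^ (2 * k + d + 1) * q ^ d.choose 2 =
      q ^ (k + d + (k + d).choose 2 + (k + d) * (k + d)) * q ^ (k + 1).choose 2 := by
    rw [← pow_mul, ← pow_add, ← pow_add]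
    congr 1
    qify
    simp only [Nat.cast_choose_two]
    push_cast
    ring
  have e2 : (q ^ (k + d)) ^ d * q ^ (k + d + 1 + k).choose 2 =
      q ^ (k + d + (k + d).choose 2 + (k + d) * (k + d)) * q ^ (k + 1).choose 2 := by
    rw [← pow_mul, ← pow_add, ← pow_add]
    congr 1
    qify
    simp only [Nat.cast_choose_two]
    push_cast
    ring
  have e3 : ((-1 : R) ^ k) ^ 2 = 1 := by rw [← pow_mul, mul_comm, pow_mul, neg_one_sq, one_pow]
  linear_combination ((-1) ^ d * d * gaussBinom q (2 * (k + d) + 1) d) * e1 +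
    ((-1) ^ (k + d + 1 + k) * ↑(k + d + 1 + k) *
      gaussBinom q (2 * (k + d) + 1) (k + d + 1 + k)) * e2 -
    (d * gaussBinom q (2 * (k + d) + 1) d * (-1) ^ d *
      q ^ (k + d + (k + d).choose 2 + (k + d) * (k + d)) * q ^ (k + 1).choose 2) * e3

end GaussBinom

/-! ### Euler's function and Jacobi's identity as power series -/

section EulerFunction

variable {R : Type*} [CommRing R]

theorem X_pow_dvd_qFactorial_sub {m n : ℕ} (h : m ≤ n) :
    (X : R⟦X⟧) ^ (m + 1) ∣ qFactorial X n - qFactorial X m := by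
  induction n, h using Nat.le_induction with
  | base => simp
  | succ n hn ih =>
    rw [qFactorial_succ, show qFactorial (X : R⟦X⟧) n * (1 - X ^ (n + 1)) - qFactorial X m =
      (qFactorial X n - qFactorial X m) - X ^ (n + 1) * qFactorial X n by ring]
    exact dvd_sub ih ((pow_dvd_pow X (by omega)).mul_right _)

theorem X_pow_dvd_pentagonalSeries_sub (m : ℕ) :
    X ^ (m + 1) ∣ pentagonalSeries R - qFactorial X m := by
  rw [X_pow_dvd_iff]
  intro d hd
  obtain ⟨N, h1, h2⟩ := ((Filter.tendsto_finset_range.eventually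
    (coeff_prod_one_sub_X_pow_eventually_eq R d)).and (Filter.eventually_ge_atTop m)).exists
  rw [map_sub, ← h1, ← map_sub]
  exact X_pow_dvd_iff.mp (X_pow_dvd_qFactorial_sub h2) d hd

theorem constantCoeff_pentagonalSeries : constantCoeff (pentagonalSeries R) = 1 := by
  have h := coeff_pentagonalSeries_pentagonal R 0
  rw [show pentagonal 0 = 0 from rfl] at h
  simpa using h

theorem isUnit_pentagonalSeries : IsUnit (pentagonalSeries R) := by
  rw [isUnit_iff_constantCoeff, constantCoeff_pentagonalSeries]
  exact isUnit_one

theorem X_pow_dvd_gaussBinom_mul_sub_one {n a b : ℕ} (ha : n ≤ a) (hb : n ≤ b) :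
    X ^ (n + 1) ∣ gaussBinom X (a + b) a * pentagonalSeries R - 1 := by
  have h (m : ℕ) (hm : n ≤ m) : X ^ (n + 1) ∣ pentagonalSeries R - qFactorial X m :=
    (pow_dvd_pow X (by omega)).trans (X_pow_dvd_pentagonalSeries_sub m)
  rw [← (isUnit_pentagonalSeries (R := R)).dvd_mul_left]
  have e : pentagonalSeries R * (gaussBinom X (a + b) a * pentagonalSeries R - 1) =
      gaussBinom X (a + b) a * pentagonalSeries R * (pentagonalSeries R - qFactorial X a) +
      gaussBinom X (a + b) a * qFactorial X a * (pentagonalSeries R - qFactorial X b) -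
      (pentagonalSeries R - qFactorial X (a + b)) := by
    linear_combination gaussBinom_mul_qFactorial (X : R⟦X⟧) a b
  rw [e]
  exact dvd_sub (dvd_add ((h a ha).mul_left _) ((h b hb).mul_left _)) (h _ (by omega))

/-- **Jacobi's identity** for the cube of Euler's function, as a congruence modulo powers of `X`. -/
theorem X_pow_dvd_pentagonalSeries_pow_three_sub [IsDomain R] (n : ℕ) :
    X ^ (n + 1) ∣ pentagonalSeries R ^ 3 - ∑ k ∈ Finset.range (n + 1),
      (-1) ^ k * ((2 * k + 1 : ℕ) : R⟦X⟧) * X ^ ((k + 1).choose 2) := by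
  have e : pentagonalSeries R ^ 3 - ∑ k ∈ Finset.range (n + 1),
      (-1) ^ k * ((2 * k + 1 : ℕ) : R⟦X⟧) * X ^ ((k + 1).choose 2) =
      pentagonalSeries R * (pentagonalSeries R + qFactorial X n) *
        (pentagonalSeries R - qFactorial X n) +
      ∑ k ∈ Finset.range (n + 1), (-1) ^ k * (X ^ ((k + 1).choose 2) *
        (((n + 1 + k : ℕ) : R⟦X⟧) *
          (gaussBinom X (2 * n + 1) (n + 1 + k) * pentagonalSeries R - 1) -
        ((n - k : ℕ) : R⟦X⟧) * (gaussBinom X (2 * n + 1) (n - k) * pentagonalSeries R - 1))) := by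
    have e1 : pentagonalSeries R * (pentagonalSeries R + qFactorial X n) *
        (pentagonalSeries R - qFactorial X n) = pentagonalSeries R ^ 3 -
        pentagonalSeries R * qFactorial X n ^ 2 := by ring
    rw [e1, qFactorial_sq_eq_sum X_ne_zero, Finset.mul_sum, sub_add, ← Finset.sum_sub_distrib]
    congr 1
    refine Finset.sum_congr rfl fun k hk => ?_
    obtain ⟨d, rfl⟩ := Nat.exists_eq_add_of_le (Finset.mem_range_succ_iff.mp hk)
    rw [show k + d - k = d by omega]
    push_cast
    ring
  rw [e]
  refine dvd_add ((X_pow_dvd_pentagonalSeries_sub n).mul_left _)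
    (Finset.dvd_sum fun k hk => Dvd.dvd.mul_left ?_ _)
  have hk := Finset.mem_range_succ_iff.mp hk
  have hc : k ≤ (k + 1).choose 2 := by
    rw [Nat.choose_succ_succ' k 1, Nat.choose_one_right]
    omega
  -- The binomials are accurate only to order n-k, but the factor X^(k(k+1)/2) makes up the loss of
  -- k.
  refine (pow_dvd_pow X (show n + 1 ≤ (k + 1).choose 2 + (n - k + 1) by omega)).trans ?_
  rw [pow_add]
  have h1 := X_pow_dvd_gaussBinom_mul_sub_one (R := R) (n := n - k) (a := n + 1 + k) (b := n - k)
    (by omega) le_rfl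
  have h2 := X_pow_dvd_gaussBinom_mul_sub_one (R := R) (n := n - k) (a := n - k) (b := n + 1 + k)
    le_rfl (by omega)
  rw [show n + 1 + k + (n - k) = 2 * n + 1 by omega] at h1
  rw [show n - k + (n + 1 + k) = 2 * n + 1 by omega] at h2
  exact mul_dvd_mul_left _ (dvd_sub (h1.mul_left _) (h2.mul_left _))

/-- The condition on 2k+1 is essential later: in characteristic p it discards the terms of Jacobi's
series whose coefficient vanishes. -/
theorem exists_of_coeff_pentagonalSeries_pow_three_ne_zero [IsDomain R] {m : ℕ}
    (h : coeff m (pentagonalSeries R ^ 3) ≠ 0) :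
    ∃ k : ℕ, 2 * m = (k + 1) * k ∧ ((2 * k + 1 : ℕ) : R) ≠ 0 := by
  have h1 := X_pow_dvd_iff.mp (X_pow_dvd_pentagonalSeries_pow_three_sub (R := R) m) m m.lt_succ_self
  rw [map_sub, sub_eq_zero] at h1
  rw [h1, map_sum] at h
  obtain ⟨k, -, hk⟩ := Finset.exists_ne_zero_of_sum_ne_zero h
  have hc : ((-1) ^ k * ((2 * k + 1 : ℕ) : R⟦X⟧) * X ^ ((k + 1).choose 2)) =
      C ((-1) ^ k * ((2 * k + 1 : ℕ) : R)) * X ^ ((k + 1).choose 2) := by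
    rw [map_mul, map_pow, map_neg, map_one, map_natCast]
  rw [hc, coeff_C_mul, coeff_X_pow] at hk
  refine ⟨k, ?_, right_ne_zero_of_mul (left_ne_zero_of_mul hk)⟩
  have hm : m = (k + 1).choose 2 := by
    by_contra hne
    simp [hne] at hk
  rw [hm, Nat.choose_two_right, Nat.mul_div_cancel' (Nat.even_mul_pred_self _).two_dvd,
    Nat.add_sub_cancel]

theorem exists_of_coeff_pentagonalSeries_ne_zero {m : ℕ} (h : coeff m (pentagonalSeries R) ≠ 0) :
    ∃ k : ℤ, 2 * (m : ℤ) = k * (3 * k - 1) := by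
  by_contra hne
  refine h (coeff_pentagonalSeries_eq_zero R fun ⟨k, hk⟩ => hne ⟨k, ?_⟩)
  rw [← hk, two_mul_natCast_pentagonal]

theorem coeff_pentagonalSeries_of_two_mul_eq {m : ℕ} {k : ℤ} (h : 2 * (m : ℤ) = k * (3 * k - 1)) :
    coeff m (pentagonalSeries R) = Int.negOnePow k := by
  rw [← two_mul_natCast_pentagonal] at h
  rw [show m = pentagonal k by omega, coeff_pentagonalSeries_pentagonal]

theorem map_pentagonalSeries {S : Type*} [CommRing S] (f : R →+* S) :
    map f (pentagonalSeries R) = pentagonalSeries S := by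
  ext n
  rw [coeff_map]
  by_cases h : n ∈ Set.range pentagonal
  · obtain ⟨k, rfl⟩ := h
    simp only [coeff_pentagonalSeries_pentagonal, map_intCast]
  · rw [coeff_pentagonalSeries_eq_zero R h, coeff_pentagonalSeries_eq_zero S h, map_zero]

end EulerFunction

/-! ### Product identities for the generating function -/

section GeneratingFunction

open scoped PowerSeries.WithPiTopology

theorem continuous_expand {R : Type*} [CommRing R] [TopologicalSpace R] (k : ℕ) (hk : k ≠ 0) :
    Continuous (expand k hk : R⟦X⟧ → R⟦X⟧) := by
  refine continuous_iff_continuousAt.mpr fun f => ?_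
  refine (PowerSeries.WithPiTopology.tendsto_iff_coeff_tendsto R _ _ _).mpr fun d => ?_
  by_cases h : k ∣ d
  · obtain ⟨e, rfl⟩ := h
    simp only [coeff_expand_mul]
    exact (PowerSeries.WithPiTopology.continuous_coeff R e).continuousAt
  · simp only [coeff_expand_of_not_dvd k hk _ h]
    exact tendsto_const_nhds

theorem qPochhammerInf_X_X : qPochhammerInf X X = pentagonalSeries ℤ := by
  rw [qPochhammerInf, ← PowerSeries.WithPiTopology.tprod_one_sub_X_pow ℤ]
  simp only [pow_succ']

theorem expand_qPochhammerInf {a q : ℤ⟦X⟧} (hq : constantCoeff q = 0) (k : ℕ) (hk : k ≠ 0) :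
    expand k hk (qPochhammerInf a q) = qPochhammerInf (expand k hk a) (expand k hk q) := by
  rw [qPochhammerInf, (multipliable_qPochhammerInf hq).map_tprod _ (continuous_expand k hk)]
  simp [qPochhammerInf]

theorem qPochhammerInf_neg_mul_self {a q : ℤ⟦X⟧} (hq : constantCoeff q = 0) :
    qPochhammerInf (-a) q * qPochhammerInf a q = qPochhammerInf (a ^ 2) (q ^ 2) := by
  rw [qPochhammerInf, qPochhammerInf, ← (multipliable_qPochhammerInf hq).tprod_mul
    (multipliable_qPochhammerInf hq), qPochhammerInf]
  refine tprod_congr fun i => ?_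
  ring

end GeneratingFunction

/-! ### Reduction modulo p and extraction of arithmetic progressions -/

section ModP

variable (p : ℕ) [Fact p.Prime]

theorem expand_prime (f : (ZMod p)⟦X⟧) : expand p (Fact.out : p.Prime).ne_zero f = f ^ p := by
  have h := MvPowerSeries.map_frobenius_expand p (Fact.out : p.Prime).ne_zero (f := f)
  rw [← h, ZMod.frobenius_zmod, MvPowerSeries.map_id]
  rfl

theorem expand_prime_pow (r : ℕ) (f : (ZMod p)⟦X⟧) :
    expand (p ^ r) (pow_ne_zero r (Fact.out : p.Prime).ne_zero) f = f ^ p ^ r := by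
  have h := MvPowerSeries.map_iterateFrobenius_expand p (Fact.out : p.Prime).ne_zero f r
  rw [← h, show iterateFrobenius (ZMod p) p r = RingHom.id _ from Subsingleton.elim _ _,
    MvPowerSeries.map_id]
  rfl

/-- Multiplying the defining relation by E turns the numerator into E(q^2); modulo p the denominator
becomes (E·(-q;q)_∞)^(p^r), again a power of E(q^2). -/
theorem map_braceletGenFun_mul (r : ℕ) :
    map (Int.castRingHom (ZMod p)) (braceletGenFun (p ^ r)) *
      expand 2 two_ne_zero (pentagonalSeries (ZMod p)) ^ p ^ r =
      expand 2 two_ne_zero (pentagonalSeries (ZMod p)) := by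
  have hk : p ^ r ≠ 0 := pow_ne_zero r (Fact.out : p.Prime).ne_zero
  have h1 : qPochhammerInf (-X) X * qPochhammerInf X X =
      expand 2 two_ne_zero (pentagonalSeries ℤ) := by
    rw [qPochhammerInf_neg_mul_self constantCoeff_X, ← qPochhammerInf_X_X,
      expand_qPochhammerInf constantCoeff_X, expand_X]
  have h2 : qPochhammerInf (-X ^ p ^ r) (X ^ p ^ r) =
      expand (p ^ r) hk (qPochhammerInf (-X) X) := by
    rw [expand_qPochhammerInf constantCoeff_X, map_neg, expand_X]
  have h3 : braceletGenFun (p ^ r) * (qPochhammerInf X X ^ p ^ r *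
      expand (p ^ r) hk (qPochhammerInf (-X) X)) = expand 2 two_ne_zero (pentagonalSeries ℤ) := by
    have hd := braceletGenFun_mul_denominator hk
    rw [braceletDenominator, h2] at hd
    rw [← h1, ← pow_sub_one_mul hk (qPochhammerInf X X)]
    linear_combination qPochhammerInf X X * hd
  have h4 := congrArg (map (Int.castRingHom (ZMod p))) h3
  have h5 := congrArg (map (Int.castRingHom (ZMod p))) h1
  simp only [map_mul, map_pow, map_expand, map_pentagonalSeries, qPochhammerInf_X_X] at h4 h5
  rwa [expand_prime_pow, ← mul_pow, mul_comm (pentagonalSeries _), h5] at h4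

/-- The quotient `(q; q)_∞ / (q ^ k; q ^ k)_∞` over `ZMod p`, where `k = p ^ r`. -/
noncomputable def eulerQuotient (r : ℕ) : (ZMod p)⟦X⟧ :=
  pentagonalSeries (ZMod p) * (pentagonalSeries (ZMod p) ^ p ^ r)⁻¹

theorem eulerQuotient_mul (r : ℕ) :
    eulerQuotient p r * pentagonalSeries (ZMod p) ^ p ^ r = pentagonalSeries (ZMod p) := by
  rw [eulerQuotient, mul_assoc, PowerSeries.inv_mul_cancel, mul_one]
  rw [map_pow, constantCoeff_pentagonalSeries, one_pow]
  exact one_ne_zero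

theorem pentagonalSeries_ne_zero {R : Type*} [CommRing R] [Nontrivial R] :
    pentagonalSeries R ≠ 0 :=
  isUnit_pentagonalSeries.ne_zero

theorem braceletCount_two_mul (r n : ℕ) :
    (braceletCount (p ^ r) (2 * n) : ZMod p) = coeff n (eulerQuotient p r) := by
  have h1 := map_braceletGenFun_mul p r
  have h2 := congrArg (expand 2 two_ne_zero) (eulerQuotient_mul p r)
  rw [map_mul, map_pow] at h2
  have hne : expand 2 two_ne_zero (pentagonalSeries (ZMod p)) ^ p ^ r ≠ 0 := by
    refine ((isUnit_pentagonalSeries.map (expand 2 two_ne_zero)).pow _).ne_zero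
  have h3 := mul_right_cancel₀ hne (h2.trans h1.symm)
  rw [← coeff_expand_mul 2 two_ne_zero, h3, coeff_map]
  rfl

/-- The power series `∑ f_{s + p j} q ^ j`. -/
noncomputable def progressionSection {R : Type*} [CommRing R] (p s : ℕ) (f : R⟦X⟧) : R⟦X⟧ :=
  mk fun j => coeff (s + p * j) f

/-- A series in q^p does not mix residue classes mod p. -/
theorem progressionSection_mul_expand {R : Type*} [CommRing R] {p s : ℕ} (hs : s < p) (hp : p ≠ 0)
    (f g : R⟦X⟧) :
    progressionSection p s (f * expand p hp g) = progressionSection p s f * g := by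
  ext j
  rw [progressionSection, coeff_mk, coeff_mul, coeff_mul]
  symm
  refine Finset.sum_of_injOn (fun x => (s + p * x.1, p * x.2)) ?_ ?_ ?_ ?_
  · rintro ⟨a, b⟩ - ⟨c, d⟩ - h
    simp only [Prod.mk.injEq, add_right_inj, mul_eq_mul_left_iff, hp, or_false] at h
    exact Prod.ext h.1 h.2
  · rintro ⟨a, b⟩ h
    simp only [Finset.mem_coe, Finset.HasAntidiagonal.mem_antidiagonal] at h ⊢
    rw [← h]; ring
  · rintro ⟨a, b⟩ h h'
    by_cases hd : p ∣ b
    · obtain ⟨c, rfl⟩ := hd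
      rw [Finset.HasAntidiagonal.mem_antidiagonal] at h
      dsimp only at h
      have hc : c ≤ j := by
        by_contra hcj
        have : p * (j + 1) ≤ p * c := Nat.mul_le_mul_left p (by omega)
        rw [mul_add] at this
        omega
      obtain ⟨d, rfl⟩ := Nat.exists_eq_add_of_le hc
      refine absurd ⟨(d, c), ?_, ?_⟩ h'
      · simp [add_comm]
      · rw [mul_add] at h
        ext <;> dsimp only
        omega
    · dsimp only
      rw [coeff_expand_of_not_dvd p hp g hd, mul_zero]
  · rintro ⟨a, b⟩ -
    simp [progressionSection]

variable {p}

/-- Completing the square makes (6k-1)^2 divisible by p, and 6k-1 = (6t+1)(6m-1) recovers m.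
Allowing 6t+1 = ±p covers both classes of p mod 6. -/
theorem exists_pentagonal_of_two_mul_eq {s j : ℕ} {t k : ℤ} (ht : (6 * t + 1) ^ 2 = (p : ℤ) ^ 2)
    (hs : 24 * s + 1 = p ^ 2) (h : 2 * ((s + p * j : ℕ) : ℤ) = k * (3 * k - 1)) :
    ∃ m : ℤ, k = (6 * t + 1) * m - t ∧ j = p * pentagonal m := by
  have hp : Prime (p : ℤ) := Nat.prime_iff_prime_int.mp Fact.out
  zify at hs
  push_cast at h
  have h1 : (6 * k - 1) ^ 2 = (p : ℤ) * (p + 24 * j) := by linear_combination -12 * h + hs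
  have h2 : (6 * t + 1) ∣ 6 * k - 1 := by
    have hd : (p : ℤ) ∣ 6 * k - 1 := hp.dvd_of_dvd_pow (Dvd.intro _ h1.symm)
    rcases sq_eq_sq_iff_eq_or_eq_neg.mp ht with h | h
    · rwa [h]
    · rwa [h, neg_dvd]
  obtain ⟨w, hw⟩ := h2
  obtain ⟨m, hm⟩ : ∃ m, m = k - t * w := ⟨_, rfl⟩
  refine ⟨m, by linear_combination -t * hw - (6 * t + 1) * hm, ?_⟩
  have h3 := two_mul_natCast_pentagonal m
  have h6 : 24 * (pentagonal m : ℤ) = w ^ 2 - 1 := by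
    have hw' : w = 6 * m - 1 := by linear_combination -hw - 6 * hm
    rw [hw']
    linear_combination 12 * h3
  have h4 : (p : ℤ) * (24 * j) = p * (24 * (p * pentagonal m)) := by
    linear_combination -h1 + (6 * k - 1 + (6 * t + 1) * w) * hw + w ^ 2 * ht - (p : ℤ) ^ 2 * h6
  have h5 := mul_left_cancel₀ hp.ne_zero h4
  zify
  linarith

theorem progressionSection_pentagonalSeries {R : Type*} [CommRing R] {s : ℕ} {t : ℤ}
    (ht : (6 * t + 1) ^ 2 = (p : ℤ) ^ 2) (hs : 24 * s + 1 = p ^ 2) (hp : p ≠ 0) :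
    progressionSection p s (pentagonalSeries R) =
      C ((Int.negOnePow t : ℤ) : R) * expand p hp (pentagonalSeries R) := by
  ext j
  rw [progressionSection, coeff_mk, coeff_C_mul]
  by_cases h : ∃ k : ℤ, 2 * ((s + p * j : ℕ) : ℤ) = k * (3 * k - 1)
  · obtain ⟨k, hk⟩ := h
    obtain ⟨m, rfl, rfl⟩ := exists_pentagonal_of_two_mul_eq ht hs hk
    rw [coeff_pentagonalSeries_of_two_mul_eq hk, coeff_expand_mul,
      coeff_pentagonalSeries_pentagonal, ← Int.cast_mul, ← Units.val_mul, ← Int.negOnePow_add]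
    congr 2
    rw [Int.negOnePow_eq_iff]
    -- The index (6t+1)m - t has the parity of t + m, so the sign splits off (-1)^t.
    exact ⟨3 * t * m - t, by ring⟩
  · rw [coeff_pentagonalSeries_eq_zero R fun ⟨k, hk⟩ =>
      h ⟨k, by rw [← hk, two_mul_natCast_pentagonal]⟩]
    by_cases hj : p ∣ j
    · obtain ⟨i, rfl⟩ := hj
      rw [coeff_expand_mul, coeff_pentagonalSeries_eq_zero, mul_zero]
      rintro ⟨m, rfl⟩
      refine h ⟨(6 * t + 1) * m - t, ?_⟩
      have h3 := two_mul_natCast_pentagonal m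
      zify at hs
      push_cast
      refine mul_left_cancel₀ (show (12 : ℤ) ≠ 0 by norm_num) ?_
      linear_combination hs + 12 * (p : ℤ) ^ 2 * h3 - (6 * m - 1) ^ 2 * ht
    · rw [coeff_expand_of_not_dvd p hp _ hj, mul_zero]

theorem progressionSection_eulerQuotient_one {s : ℕ} {t : ℤ}
    (ht : (6 * t + 1) ^ 2 = (p : ℤ) ^ 2) (hs : 24 * s + 1 = p ^ 2) (hsp : s < p) :
    progressionSection p s (eulerQuotient p 1) =
      C ((Int.negOnePow t : ℤ) : ZMod p) * pentagonalSeries (ZMod p) ^ (p - 1) := by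
  have hp : p ≠ 0 := (Fact.out : p.Prime).ne_zero
  have h := congrArg (progressionSection p s) (eulerQuotient_mul p 1)
  rw [pow_one, ← expand_prime, progressionSection_mul_expand hsp,
    progressionSection_pentagonalSeries ht hs hp, expand_prime, ← pow_sub_one_mul hp,
    ← mul_assoc] at h
  exact mul_right_cancel₀ pentagonalSeries_ne_zero h

theorem progressionSection_eulerQuotient_add_two {s : ℕ} {t : ℤ} (r : ℕ)
    (ht : (6 * t + 1) ^ 2 = (p : ℤ) ^ 2) (hs : 24 * s + 1 = p ^ 2) (hsp : s < p) :
    progressionSection p s (eulerQuotient p (r + 2)) =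
      C ((Int.negOnePow t : ℤ) : ZMod p) *
        expand p (Fact.out : p.Prime).ne_zero (eulerQuotient p r) := by
  have hp : p ≠ 0 := (Fact.out : p.Prime).ne_zero
  have h := congrArg (progressionSection p s) (eulerQuotient_mul p (r + 2))
  rw [show r + 2 = r + 1 + 1 from rfl, pow_succ, pow_mul, ← expand_prime,
    progressionSection_mul_expand hsp, progressionSection_pentagonalSeries ht hs hp] at h
  refine mul_right_cancel₀ (pow_ne_zero (p ^ (r + 1)) pentagonalSeries_ne_zero) (h.trans ?_)
  conv_lhs => rw [← eulerQuotient_mul p r]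
  rw [map_mul, map_pow, expand_prime p (pentagonalSeries _), ← pow_mul, ← pow_succ', mul_assoc]

/-- A vanishing progression for the `(p - 1)`-st power of Euler's function gives vanishing
progressions for the quotients `(q; q)_∞ / (q ^ k; q ^ k)_∞`, where `k` is an odd power of `p`. -/
theorem coeff_eulerQuotient_eq_zero {s c N : ℕ} {t : ℤ}
    (ht : (6 * t + 1) ^ 2 = (p : ℤ) ^ 2) (hs : 24 * s + 1 = p ^ 2) (hsp : s < p)
    (hc : ∀ n, coeff (p * n + c) (pentagonalSeries (ZMod p) ^ (p - 1)) = 0) (a n : ℕ)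
    (hN : 24 * N + 1 = p ^ (2 * a + 1) * (24 * (p * n + c) + p)) :
    coeff N (eulerQuotient p (2 * a + 1)) = 0 := by
  have hp : 0 < p := (Fact.out : p.Prime).pos
  induction a generalizing N with
  | zero =>
    have e : N = s + p * (p * n + c) := by
      have : 24 * N + 1 = 24 * (s + p * (p * n + c)) + 1 := by
        rw [hN]; linear_combination hs.symm
      omega
    have h := congrArg (coeff (p * n + c)) (progressionSection_eulerQuotient_one ht hs hsp)
    rwa [coeff_C_mul, hc, mul_zero, progressionSection, coeff_mk, ← e] at h
  | succ a ih =>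
    obtain ⟨Q, hQ⟩ : ∃ Q, Q = p ^ (2 * a + 1) * (24 * (p * n + c) + p) := ⟨_, rfl⟩
    have hQ0 : 0 < Q := hQ ▸ by positivity
    have h1 : 24 * N + 1 = 24 * (s * Q) + Q := by
      rw [hN, hQ]; linear_combination (p ^ (2 * a + 1) * (24 * (p * n + c) + p)) * hs.symm
    obtain ⟨M, rfl⟩ := Nat.exists_eq_add_of_le (show s * Q ≤ N by omega)
    have h2 : 24 * M + 1 = Q := by omega
    -- Here 24N+1 = p^2(24M+1), so N lies in the class of s and corresponds to M two levels down.
    have e : s * Q + M = s + p * (p * M) := by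
      rw [← h2]; linear_combination M * hs
    have h := congrArg (coeff (p * M))
      (progressionSection_eulerQuotient_add_two (2 * a + 1) ht hs hsp)
    rwa [coeff_C_mul, coeff_expand_mul, ih (h2.trans hQ), mul_zero, progressionSection, coeff_mk,
      ← e] at h

end ModP

/-! ### Vanishing progressions of E^4 mod 5 and E^6 mod 7 -/

theorem coeff_mul_eq_zero {R : Type*} [CommRing R] {f g : R⟦X⟧} {n : ℕ}
    (h : ∀ i j, i + j = n → coeff i f ≠ 0 → coeff j g ≠ 0 → False) : coeff n (f * g) = 0 := by
  rw [coeff_mul]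
  refine Finset.sum_eq_zero fun x hx => ?_
  by_contra hne
  exact h x.1 x.2 (Finset.HasAntidiagonal.mem_antidiagonal.mp hx) (left_ne_zero_of_mul hne)
    (right_ne_zero_of_mul hne)

section Residues

variable (p : ℕ) [Fact p.Prime]

theorem exists_zmod_of_coeff_pentagonalSeries_ne_zero {m : ℕ}
    (h : coeff m (pentagonalSeries (ZMod p)) ≠ 0) :
    ∃ k : ZMod p, 2 * (m : ZMod p) = k * (3 * k - 1) := by
  obtain ⟨k, hk⟩ := exists_of_coeff_pentagonalSeries_ne_zero h
  exact ⟨k, by exact_mod_cast congrArg (Int.cast : ℤ → ZMod p) hk⟩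

theorem exists_zmod_of_coeff_pentagonalSeries_pow_three_ne_zero {m : ℕ}
    (h : coeff m (pentagonalSeries (ZMod p) ^ 3) ≠ 0) :
    ∃ k : ZMod p, 2 * (m : ZMod p) = (k + 1) * k ∧ 2 * k + 1 ≠ 0 := by
  obtain ⟨k, hk, hk'⟩ := exists_of_coeff_pentagonalSeries_pow_three_ne_zero h
  exact ⟨k, by exact_mod_cast congrArg (Nat.cast : ℕ → ZMod p) hk, by exact_mod_cast hk'⟩

end Residues

instance : Fact (Nat.Prime 5) := ⟨by norm_num⟩
instance : Fact (Nat.Prime 11) := ⟨by norm_num⟩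
instance : Fact (Nat.Prime 7) := ⟨by norm_num⟩

theorem coeff_pentagonalSeries_pow_four (n : ℕ) :
    coeff (5 * n + 4) (pentagonalSeries (ZMod 5) ^ 4) = 0 := by
  rw [pow_succ']
  refine coeff_mul_eq_zero fun i j hij hi hj => ?_
  obtain ⟨k, hk⟩ := exists_zmod_of_coeff_pentagonalSeries_ne_zero 5 hi
  obtain ⟨l, hl, hl'⟩ := exists_zmod_of_coeff_pentagonalSeries_pow_three_ne_zero 5 hj
  have h := congrArg (Nat.cast : ℕ → ZMod 5) hij
  have h5 : (5 : ZMod 5) = 0 := rfl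
  push_cast at h
  rw [h5, zero_mul, zero_add] at h
  have h1 : k * (3 * k - 1) + (l + 1) * l = 2 * 4 := by rw [← hk, ← hl, ← mul_add, h]
  clear hk hl
  revert k l
  -- `h1` says (6k-1)^2 + 3(2l+1)^2 = 0 in `ZMod 5`. As -3 is a nonresidue, 2l+1 = 0, against `hl'`.
  decide

theorem coeff_pentagonalSeries_pow_six (n : ℕ) :
    coeff (7 * n + 5) (pentagonalSeries (ZMod 7) ^ 6) = 0 := by
  rw [show 6 = 3 + 3 from rfl, pow_add]
  refine coeff_mul_eq_zero fun i j hij hi hj => ?_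
  obtain ⟨k, hk, hk'⟩ := exists_zmod_of_coeff_pentagonalSeries_pow_three_ne_zero 7 hi
  obtain ⟨l, hl, hl'⟩ := exists_zmod_of_coeff_pentagonalSeries_pow_three_ne_zero 7 hj
  have h := congrArg (Nat.cast : ℕ → ZMod 7) hij
  have h7 : (7 : ZMod 7) = 0 := rfl
  push_cast at h
  rw [h7, zero_mul, zero_add] at h
  have h1 : (k + 1) * k + (l + 1) * l = 2 * 5 := by rw [← hk, ← hl, ← mul_add, h]
  clear hk hl
  revert k l
  -- `h1` says (2k+1)^2 + (2l+1)^2 = 0 in `ZMod 7`, where -1 is a nonresidue, so both squares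
  -- vanish.
  decide

/-! ### Vanishing progression of E^10 mod 11 -/

section ResiduePart

variable {R : Type*} [CommRing R] {p : ℕ}

/-- The terms of a power series whose exponents lie in a given residue class. -/
noncomputable def residuePart (a : ZMod p) (f : R⟦X⟧) : R⟦X⟧ :=
  mk fun n => if (n : ZMod p) = a then coeff n f else 0

theorem residuePart_eq_zero_iff {a : ZMod p} {f : R⟦X⟧} :
    residuePart a f = 0 ↔ ∀ n : ℕ, (n : ZMod p) = a → coeff n f = 0 := by
  simp [PowerSeries.ext_iff, residuePart]

theorem residuePart_mul [NeZero p] (a : ZMod p) (f g : R⟦X⟧) :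
    residuePart a (f * g) = ∑ b, residuePart b f * residuePart (a - b) g := by
  ext n
  simp only [residuePart, coeff_mk, map_sum, coeff_mul, mul_ite, ite_mul, zero_mul, mul_zero]
  rw [Finset.sum_comm]
  have h : ∀ y ∈ Finset.HasAntidiagonal.antidiagonal n,
      (∑ b : ZMod p, if (y.2 : ZMod p) = a - b then
        if (y.1 : ZMod p) = b then coeff y.1 f * coeff y.2 g else 0 else 0) =
      if (n : ZMod p) = a then coeff y.1 f * coeff y.2 g else 0 := by
    intro y hy
    rw [Finset.sum_eq_single (y.1 : ZMod p) (fun b _ hb => by simp [hb.symm]) (by simp)]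
    simp [← Finset.HasAntidiagonal.mem_antidiagonal.mp hy, eq_sub_iff_add_eq']
  rw [Finset.sum_congr rfl h]
  split_ifs <;> simp

theorem sum_zmod_eleven {M : Type*} [AddCommMonoid M] (f : ZMod 11 → M) :
    ∑ a, f a = f 0 + f 1 + f 2 + f 3 + f 4 + f 5 + f 6 + f 7 + f 8 + f 9 + f 10 := by
  have h (g : Fin 11 → M) :
      ∑ a, g a = g 0 + g 1 + g 2 + g 3 + g 4 + g 5 + g 6 + g 7 + g 8 + g 9 + g 10 := by
    simp only [Fin.sum_univ_castSucc, Fin.sum_univ_zero, zero_add]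
    rfl
  exact h f

end ResiduePart

-- With f split into its five surviving classes j0, j1, j3, j6, j10, the hypotheses on f^4 are five
-- quartic relations. Modulo 11, class 6 of f^7 is a combination of these with cubic multipliers.
set_option linter.unusedSimpArgs false in
theorem residuePart_six_pow_seven (f : (ZMod 11)⟦X⟧)
    (h : ∀ a ∈ ({2, 4, 5, 7, 8, 9} : Finset (ZMod 11)), residuePart a f = 0)
    (h4 : ∀ a ∈ ({3, 6, 8, 9, 10} : Finset (ZMod 11)), residuePart a (f ^ 4) = 0) :
    residuePart (6 : ZMod 11) (f ^ 7) = 0 := by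
  simp only [Finset.forall_mem_insert, Finset.mem_singleton, forall_eq] at h h4
  obtain ⟨z2, z4, z5, z7, z8, z9⟩ := h
  have e2 (a : ZMod 11) := residuePart_mul a f f
  simp only [sum_zmod_eleven, z2, z4, z5, z7, z8, z9, zero_mul, add_zero, ← sq] at e2
  obtain ⟨j0, hj0⟩ : ∃ g, g = residuePart (0 : ZMod 11) f := ⟨_, rfl⟩
  obtain ⟨j1, hj1⟩ : ∃ g, g = residuePart (1 : ZMod 11) f := ⟨_, rfl⟩
  obtain ⟨j3, hj3⟩ : ∃ g, g = residuePart (3 : ZMod 11) f := ⟨_, rfl⟩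
  obtain ⟨j6, hj6⟩ : ∃ g, g = residuePart (6 : ZMod 11) f := ⟨_, rfl⟩
  obtain ⟨j10, hj10⟩ : ∃ g, g = residuePart (10 : ZMod 11) f := ⟨_, rfl⟩
  simp only [← hj0, ← hj1, ← hj3, ← hj6, ← hj10] at e2
  have e3 (a : ZMod 11) := residuePart_mul a f (f ^ 2)
  simp only [sum_zmod_eleven, z2, z4, z5, z7, z8, z9, ← hj0, ← hj1, ← hj3, ← hj6, ← hj10, zero_mul, add_zero] at e3
  have e4 (a : ZMod 11) := residuePart_mul a (f ^ 2) (f ^ 2)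
  simp only [sum_zmod_eleven, ← pow_add] at e4
  have e7 := residuePart_mul (6 : ZMod 11) (f * f ^ 2) (f ^ 2 * f ^ 2)
  rw [show f * f ^ 2 * (f ^ 2 * f ^ 2) = f ^ 7 by ring] at e7
  obtain ⟨v0, v1, v2, v3, v4, v5, v6, v7, v8, v9, v10⟩ :
      residuePart (0 : ZMod 11) (f ^ 2) = 2 * j1 * j10 + j0 ^ 2 ∧
      residuePart (1 : ZMod 11) (f ^ 2) = j6 ^ 2 + 2 * j0 * j1 ∧
      residuePart (2 : ZMod 11) (f ^ 2) = 2 * j3 * j10 + j1 ^ 2 ∧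
      residuePart (3 : ZMod 11) (f ^ 2) = 2 * j0 * j3 ∧
      residuePart (4 : ZMod 11) (f ^ 2) = 2 * j1 * j3 ∧
      residuePart (5 : ZMod 11) (f ^ 2) = 2 * j6 * j10 ∧
      residuePart (6 : ZMod 11) (f ^ 2) = j3 ^ 2 + 2 * j0 * j6 ∧
      residuePart (7 : ZMod 11) (f ^ 2) = 2 * j1 * j6 ∧
      residuePart (8 : ZMod 11) (f ^ 2) = 0 ∧
      residuePart (9 : ZMod 11) (f ^ 2) = j10 ^ 2 + 2 * j3 * j6 ∧
      residuePart (10 : ZMod 11) (f ^ 2) = 2 * j0 * j10 := by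
    refine ⟨?_, ?_, ?_, ?_, ?_, ?_, ?_, ?_, ?_, ?_, ?_⟩ <;>
    · rw [e2]
      reduce_mod_char
      simp only [z2, z4, z5, z7, z8, z9, ← hj0, ← hj1, ← hj3, ← hj6, ← hj10]
      ring
  simp only [sum_zmod_eleven, e3, ← pow_add, e4] at e7
  have r3 := e4 3
  have r6 := e4 6
  have r8 := e4 8
  have r9 := e4 9
  have r10 := e4 10
  reduce_mod_char at e7 r3 r6 r8 r9 r10
  obtain ⟨y3, y6, y8, y9, y10⟩ := h4
  simp only [v0, v1, v2, v3, v4, v5, v6, v7, v8, v9, v10] at e7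
  rw [y3] at r3
  simp only [v0, v1, v2, v3, v4, v5, v6, v7, v8, v9, v10] at r3
  rw [y6] at r6
  simp only [v0, v1, v2, v3, v4, v5, v6, v7, v8, v9, v10] at r6
  rw [y8] at r8
  simp only [v0, v1, v2, v3, v4, v5, v6, v7, v8, v9, v10] at r8
  rw [y9] at r9
  simp only [v0, v1, v2, v3, v4, v5, v6, v7, v8, v9, v10] at r9
  rw [y10] at r10
  simp only [v0, v1, v2, v3, v4, v5, v6, v7, v8, v9, v10] at r10
  have h11 : (11 : (ZMod 11)⟦X⟧) = 0 := by
    rw [← map_ofNat (C (R := ZMod 11)) 11, show (OfNat.ofNat 11 : ZMod 11) = 0 from rfl, map_zero]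
  -- An explicit ideal membership certificate; the `h11` term absorbs the coefficients divisible by
  -- 11.
  linear_combination e7 + (j1 * j3 * j10 + j1 ^ 3 - 4 * j0 ^ 2 * j3) * r3 + (-4 * j6 ^ 2 * j10 +
    j0 * j1 * j10 + j0 ^ 3) * r6 + (j3 ^ 3 - 4 * j0 * j10 ^ 2 + j0 * j3 * j6) * r8 + (j10 ^ 3 +
    j3 * j6 * j10 - 4 * j1 ^ 2 * j6) * r9 + (j6 ^ 3 - 4 * j1 * j3 ^ 2 + j0 * j1 * j6) * r10 +
    (j6 ^ 5 * j10 ^ 2 + j3 * j6 ^ 6 + j3 ^ 6 * j10 + j1 * j10 ^ 6 + 22 * j1 * j3 * j6 * j10 ^ 4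
    + 54 * j1 * j3 ^ 2 * j6 ^ 2 * j10 ^ 2 + 12 * j1 * j3 ^ 3 * j6 ^ 3 + j1 ^ 2 * j3 ^ 5 + 12 *
    j1 ^ 3 * j6 * j10 ^ 3 + 30 * j1 ^ 3 * j3 * j6 ^ 2 * j10 + j1 ^ 5 * j6 ^ 2 + 12 * j0 * j3 ^ 3
    * j10 ^ 3 + 22 * j0 * j3 ^ 4 * j6 * j10 + 30 * j0 * j1 * j6 ^ 3 * j10 ^ 2 + 22 * j0 * j1 *
    j3 * j6 ^ 4 + 54 * j0 * j1 ^ 2 * j3 ^ 2 * j10 ^ 2 + 30 * j0 * j1 ^ 2 * j3 ^ 3 * j6 + 22 * j0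
    * j1 ^ 4 * j3 * j10 + j0 * j1 ^ 6 + j0 ^ 2 * j10 ^ 5 + 30 * j0 ^ 2 * j3 * j6 * j10 ^ 3 + 54
    * j0 ^ 2 * j3 ^ 2 * j6 ^ 2 * j10 + 54 * j0 ^ 2 * j1 ^ 2 * j6 * j10 ^ 2 + 54 * j0 ^ 2 * j1 ^
    2 * j3 * j6 ^ 2 + 12 * j0 ^ 3 * j6 ^ 3 * j10 + 30 * j0 ^ 3 * j1 * j3 ^ 2 * j10 + 12 * j0 ^ 3
    * j1 ^ 3 * j3 + 22 * j0 ^ 4 * j1 * j6 * j10 + j0 ^ 5 * j3 ^ 2 + j0 ^ 6 * j6) * h11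

/-- Triangular numbers mod 11 take the values 0, 1, 3, 4, 6, 10; the value 4 occurs only at k = 5,
where 2k+1 = 0. -/
theorem residuePart_pentagonalSeries_pow_three (a : ZMod 11)
    (ha : a ∈ ({2, 4, 5, 7, 8, 9} : Finset (ZMod 11))) :
    residuePart a (pentagonalSeries (ZMod 11) ^ 3) = 0 := by
  rw [residuePart_eq_zero_iff]
  rintro n rfl
  by_contra hne
  obtain ⟨k, hk, hk'⟩ := exists_zmod_of_coeff_pentagonalSeries_pow_three_ne_zero 11 hne
  generalize (n : ZMod 11) = m at ha hk
  clear hne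
  revert m k
  decide

/-- Since E^12 ≡ E·E(q^11), only the pentagonal residues 0, 1, 2, 4, 5, 7 occur. -/
theorem residuePart_pentagonalSeries_pow_twelve (a : ZMod 11)
    (ha : a ∈ ({3, 6, 8, 9, 10} : Finset (ZMod 11))) :
    residuePart a ((pentagonalSeries (ZMod 11) ^ 3) ^ 4) = 0 := by
  rw [residuePart_eq_zero_iff, ← pow_mul, show 3 * 4 = 1 + 11 from rfl, pow_add, pow_one,
    ← expand_prime]
  rintro n rfl
  refine coeff_mul_eq_zero fun i j hij hi hj => ?_
  have hj' : 11 ∣ j := by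
    by_contra h
    exact hj (coeff_expand_of_not_dvd _ _ _ h)
  obtain ⟨k, hk⟩ := exists_zmod_of_coeff_pentagonalSeries_ne_zero 11 hi
  rw [← hij, Nat.cast_add, (ZMod.natCast_eq_zero_iff j 11).mpr hj', add_zero] at ha
  generalize (i : ZMod 11) = m at ha hk
  clear hi
  revert m k
  decide

theorem coeff_pentagonalSeries_pow_ten (n : ℕ) :
    coeff (11 * n + 6) (pentagonalSeries (ZMod 11) ^ 10) = 0 := by
  have h := residuePart_six_pow_seven _ residuePart_pentagonalSeries_pow_three
    residuePart_pentagonalSeries_pow_twelve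
  rw [← pow_mul, show 3 * 7 = 10 + 11 from rfl, pow_add, ← expand_prime,
    residuePart_eq_zero_iff] at h
  have h1 : progressionSection 11 6 (pentagonalSeries (ZMod 11) ^ 10 *
      expand 11 (Fact.out : Nat.Prime 11).ne_zero (pentagonalSeries (ZMod 11))) = 0 := by
    ext j
    rw [progressionSection, coeff_mk, map_zero]
    refine h _ ?_
    rw [Nat.cast_add, Nat.cast_mul, ZMod.natCast_self, zero_mul, add_zero]
    rfl
  rw [progressionSection_mul_expand (by norm_num)] at h1
  have h2 := (mul_eq_zero.mp h1).resolve_right pentagonalSeries_ne_zero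
  have h3 := congrArg (coeff n) h2
  rwa [progressionSection, coeff_mk, map_zero, add_comm] at h3

/-! ### Assembly of the congruences -/

theorem braceletCount_modEq_zero {p : ℕ} [Fact p.Prime] {s c A : ℕ} {t : ℤ}
    (ht : (6 * t + 1) ^ 2 = (p : ℤ) ^ 2) (hs : 24 * s + 1 = p ^ 2) (hsp : s < p)
    (hA : A = 24 * c + p)
    (hc : ∀ n, coeff (p * n + c) (pentagonalSeries (ZMod p) ^ (p - 1)) = 0)
    (α : ℕ) (hα : 1 ≤ α) (n : ℕ) :
    braceletCount (p ^ (2 * α - 1)) (2 * p ^ (2 * α) * n + (A * p ^ (2 * α - 1) - 1) / 12) ≡ 0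
      [ZMOD p] := by
  obtain ⟨a, rfl⟩ := Nat.exists_eq_add_of_le' hα
  rw [show 2 * (a + 1) - 1 = 2 * a + 1 by omega, show 2 * (a + 1) = 2 * a + 1 + 1 by omega]
  have h1 : A * p ^ (2 * a + 1) ≡ 1 [MOD 24] := by
    have e : A * p ^ (2 * a + 1) = (24 * s + 1) ^ a * (24 * (c * p + s) + 1) := by
      rw [hs, hA, ← pow_mul, pow_succ]
      linear_combination p ^ (2 * a) * hs.symm
    have h (m : ℕ) : 24 * m + 1 ≡ 1 [MOD 24] := by simp [Nat.ModEq, Nat.add_mod]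
    rw [e]
    simpa using ((h s).pow a).mul (h (c * p + s))
  -- This makes the division by 12 exact with even quotient 2M, so only even-indexed counts are
  -- involved.
  obtain ⟨M, hM⟩ : ∃ M, A * p ^ (2 * a + 1) = 24 * M + 1 :=
    ⟨A * p ^ (2 * a + 1) / 24, by unfold Nat.ModEq at h1; omega⟩
  have h2 : 2 * p ^ (2 * a + 1 + 1) * n + (A * p ^ (2 * a + 1) - 1) / 12 =
      2 * (p ^ (2 * a + 1 + 1) * n + M) := by
    rw [hM, mul_assoc]
    omega
  have h3 : 24 * (p ^ (2 * a + 1 + 1) * n + M) + 1 =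
      p ^ (2 * a + 1) * (24 * (p * n + c) + p) := by
    rw [mul_add, add_assoc, ← hM, hA]
    ring
  rw [h2, ← ZMod.intCast_eq_intCast_iff, braceletCount_two_mul, Int.cast_zero]
  exact coeff_eulerQuotient_eq_zero ht hs hsp hc a n h3

theorem mainTheorem7 (α : ℕ) (hα : 1 ≤ α) (n : ℕ) :
    braceletCount (5 ^ (2 * α - 1))
        (2 * 5 ^ (2 * α) * n + (101 * 5 ^ (2 * α - 1) - 1) / 12) ≡ 0 [ZMOD 5] ∧
    braceletCount (7 ^ (2 * α - 1))
        (2 * 7 ^ (2 * α) * n + (127 * 7 ^ (2 * α - 1) - 1) / 12) ≡ 0 [ZMOD 7] ∧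
    braceletCount (11 ^ (2 * α - 1))
        (2 * 11 ^ (2 * α) * n + (155 * 11 ^ (2 * α - 1) - 1) / 12) ≡ 0 [ZMOD 11] :=
  -- In each case s = (p^2-1)/24, t solves 6t+1 = ±p, and c is the class where E^(p-1) vanishes;
  -- 101, 127 and 155 are 24c+p.
  ⟨braceletCount_modEq_zero (p := 5) (s := 1) (c := 4) (t := -1) (by norm_num) (by norm_num)
      (by norm_num) (by norm_num) coeff_pentagonalSeries_pow_four α hα n,
    braceletCount_modEq_zero (p := 7) (s := 2) (c := 5) (t := 1) (by norm_num) (by norm_num)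
      (by norm_num) (by norm_num) coeff_pentagonalSeries_pow_six α hα n,
    braceletCount_modEq_zero (p := 11) (s := 5) (c := 6) (t := -2) (by norm_num) (by norm_num)
      (by norm_num) (by norm_num) coeff_pentagonalSeries_pow_ten α hα n⟩
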